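/- There is no binary self-dual $[48,24,10]$ code with an automorphism of type $3$-$(12,12)$. That is, there is no linear subspace $C\subseteq\mathbb F_2^{48}$ of dimension $24$ and minimum (Hamming) distance $10$ such that $C=C^{\perp}$ with respect to the standard inner product $x\cdot y=\sum_{i=1}^{48}x_iy_i$, together with a permutation $\sigma$ of the $48$ coordinates that maps $C$ onto itself and whose decomposition into disjoint cycles consists of exactly $12$ cycles of length $3$ and $12$ fixed points. -/

import Mathlib

namespace BinaryCode

/-- A binary linear code of length `n`: a linear subspace of `𝔽₂ⁿ`. -/
abbrev Code (n : ℕ) := Submodule (ZMod 2) (Fin n → ZMod 2)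

/-- The dual code: all vectors orthogonal to every codeword under the standard
inner product. -/
def dual {n : ℕ} (C : Code n) : Code n where
  carrier := {x | ∀ c ∈ C, x ⬝ᵥ c = 0}
  zero_mem' := fun c _ => zero_dotProduct c
  add_mem' := fun hx hy c hc => by rw [add_dotProduct, hx c hc, hy c hc, add_zero]
  smul_mem' := fun a x hx c hc => by rw [smul_dotProduct, hx c hc, smul_zero]

/-- A code is self-dual if it equals its dual. -/
def IsSelfDual {n : ℕ} (C : Code n) : Prop :=
  C = dual C

/-- `d` is the minimum distance of `C`: the least Hamming distance between two distinct
codewords. -/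
def HasMinDist {n : ℕ} (C : Code n) (d : ℕ) : Prop :=
  IsLeast {m : ℕ | ∃ x ∈ C, ∃ y ∈ C, x ≠ y ∧ hammingDist x y = m} d

/-- `C`, of length `n`, is an `[n, k, d]` code: it has dimension `k` and minimum
distance `d`. -/
def HasParameters {n : ℕ} (C : Code n) (k d : ℕ) : Prop :=
  Module.finrank (ZMod 2) C = k ∧ HasMinDist C d

/-- The action of a coordinate permutation on vectors: the entry in position `i` is moved to
position `σ i`. -/
def permute {n : ℕ} (σ : Equiv.Perm (Fin n)) (v : Fin n → ZMod 2) : Fin n → ZMod 2 :=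
  fun i => v (σ.symm i)

/-- A coordinate permutation is an automorphism of `C` if it maps `C` onto itself. -/
def IsAutomorphism {n : ℕ} (C : Code n) (σ : Equiv.Perm (Fin n)) : Prop :=
  permute σ '' (C : Set (Fin n → ZMod 2)) = C

/-- `σ` has type `p`-`(c, f)`: in its decomposition into disjoint cycles it has exactly `c`
cycles of length `p` and `f` fixed points, and no other cycles. (Mathlib's `cycleType` lists the
lengths of the nontrivial cycles.) -/
def HasType {n : ℕ} (σ : Equiv.Perm (Fin n)) (p c f : ℕ) : Prop :=
  σ.cycleType = Multiset.replicate c p ∧ (Finset.univ.filter fun i => σ i = i).card = f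

end BinaryCode

/-!
Let `σ` have twelve 3-cycles and twelve fixed points. The operator `1 + σ + σ²` maps a self-dual
code `C` of length 48 to vectors that are constant on the cycles. Since cycles have odd length,
these vectors form a self-orthogonal code of length 12 + 12 = 24, so the image has dimension at
most 12 (`two_mul_finrank_range_orbitTrace_le`) and the kernel has dimension at least 12. A word
in the kernel vanishes on the fixed points and has even weight on each 3-cycle, and the four
even-weight triples form a copy of `𝔽₄` on which `σ` acts as a cube root of unity. So the kernel
is a Hermitian self-orthogonal code `E` of length 12 over `𝔽₄`, of dimension at least 6, whose
weights are half the binary ones (`exists_isHermitianCode`). The weights of `E` are at least 5,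
and they are even because Hermitian norms vanish; hence they are at least 6.

No such code exists (`IsHermitianCode.finrank_lt`). If `u, v` are non-proportional words of weight
6 with `m` common nonzero coordinates, and `u = ωᵏ v` at `nₖ` of these, then `u + ωᵏ v` has weight
`12 - m - nₖ`; so `nₖ ≤ 6 - m` and `nₖ ≡ m` modulo 2, while `n₀ + n₁ + n₂ = m`. This forces `m ≤
4`, and for `m = 4` the ratios of `u` and `v` take two values, each twice. On a suitable
information set the code has a generator matrix `[I | A]`, whose rows have weight 6, so each row
of `A` has exactly one zero. These zeros lie in different columns, since otherwise `m = 5` for two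
rows. With the zeros moved to the diagonal, any two rows of `A` have `m = 4`. After rows and
columns are rescaled so that the first row and column consist of ones, a short search among the
remaining rows shows that the condition on ratios cannot hold for five of the six rows
(`no_log_matrix`).
-/

namespace BinaryCode

open Finset

/-! ### The field with four elements -/

/-- The field `𝔽₄`, seen as the vector space over `𝔽₂` with basis `1, ω`, where `ω² = ω + 1`. Only
multiplication by powers of `ω` is used; it is `F4.turn`, not the componentwise product of the
product type. -/
abbrev F4 := ZMod 2 × ZMod 2

namespace F4

/-- Multiplication by a power of a primitive cube root of unity. The pair `x` stands for the
even-weight triple `(x.1, x.2, x.1 + x.2)`, and `turn 1` shifts this triple cyclically. -/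
def turn (k : ZMod 3) (x : F4) : F4 :=
  match k with
  | 0 => x
  | 1 => (x.2, x.1 + x.2)
  | 2 => (x.1 + x.2, x.1)

/-- The trace of the Hermitian form of `𝔽₄`, which is the standard inner product of the
even-weight triples `(x.1, x.2, x.1 + x.2)` and `(y.1, y.2, y.1 + y.2)`. -/
def form (x y : F4) : ZMod 2 := x.1 * y.2 + x.2 * y.1

/-- The discrete logarithm on the nonzero elements of `𝔽₄`, with respect to `turn 1`. Its value at
`0` is `2` and carries no meaning. -/
def log (x : F4) : ZMod 3 :=
  if x = (1, 0) then 0 else if x = (0, 1) then 1 else 2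

theorem form_turn_one (x : F4) : form x (turn 1 x) = if x ≠ 0 then 1 else 0 := by
  revert x; decide

end F4

/-! ### A matrix of logarithms -/

/-- Four values in `ZMod 3` form two pairs of equal values, with different values in the two
pairs. For the logarithms of `x₁, …, x₄ ∈ 𝔽₄ˣ` this means that `∑ xᵢ = 0` and the `xᵢ` are not all
equal. -/
def Balanced (a b c d : ZMod 3) : Prop :=
  (a = b ∧ c = d ∧ a ≠ c) ∨ (a = c ∧ b = d ∧ a ≠ b) ∨ (a = d ∧ b = c ∧ a ≠ b)

instance (a b c d : ZMod 3) : Decidable (Balanced a b c d) := by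
  unfold Balanced; infer_instance

set_option synthInstance.maxHeartbeats 400000 in
set_option synthInstance.maxSize 4000 in
set_option maxRecDepth 10000 in
/-- The rows `1, …, 4` of a `6 × 6` logarithm matrix with empty diagonal, normalized so that row
`0` and column `0` vanish, cannot be pairwise balanced. The row `a` is checked against row `0`,
then each further row against row `0` and all earlier rows; no choice of a fourth row survives. -/
theorem no_normalized_log_matrix :
    ∀ a₂ a₃ a₄ a₅ : ZMod 3, Balanced a₂ a₃ a₄ a₅ →
    ∀ b₁ b₃ b₄ b₅ : ZMod 3, Balanced b₁ b₃ b₄ b₅ →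
      Balanced 0 (a₃ - b₃) (a₄ - b₄) (a₅ - b₅) →
    ∀ c₁ c₂ c₄ c₅ : ZMod 3, Balanced c₁ c₂ c₄ c₅ →
      Balanced 0 (a₂ - c₂) (a₄ - c₄) (a₅ - c₅) → Balanced 0 (b₁ - c₁) (b₄ - c₄) (b₅ - c₅) →
    ∀ d₁ d₂ d₃ d₅ : ZMod 3, Balanced d₁ d₂ d₃ d₅ →
      Balanced 0 (a₂ - d₂) (a₃ - d₃) (a₅ - d₅) → Balanced 0 (b₁ - d₁) (b₃ - d₃) (b₅ - d₅) →
      ¬ Balanced 0 (c₁ - d₁) (c₂ - d₂) (c₅ - d₅) := by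
  decide +kernel

theorem Balanced.sub {a b c d : ZMod 3} (h : Balanced a b c d) (t : ZMod 3) :
    Balanced (a - t) (b - t) (c - t) (d - t) := by
  simpa only [Balanced, sub_left_inj, ne_eq] using h

/-- Four values in `ZMod 3`, each value occurring zero times or twice, are balanced. -/
theorem balanced_of_counts : ∀ a b c d : ZMod 3,
    (∀ k : ZMod 3,
      let m := (if a = k then 1 else 0) + (if b = k then 1 else 0) + (if c = k then 1 else 0) +
        (if d = k then 1 else 0)
      m ≤ 2 ∧ m % 2 = 0) → Balanced a b c d := by
  decide

/-- There is no `6 × 6` matrix over `ZMod 3` in which, for any two rows `i, j`, the differences of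
the two rows in the four columns other than `i, j` are balanced. Here `g` lists the two rows, then
the four columns; the diagonal of `L` plays no role. -/
theorem no_log_matrix (L : Fin 6 → Fin 6 → ZMod 3)
    (h : ∀ g : Fin 6 → Fin 6, g.Injective →
      Balanced (L (g 0) (g 2) - L (g 1) (g 2)) (L (g 0) (g 3) - L (g 1) (g 3))
        (L (g 0) (g 4) - L (g 1) (g 4)) (L (g 0) (g 5) - L (g 1) (g 5))) : False := by
  -- Normalize `L` by subtracting from each row first row `0`, then its own entry in column `0`.
  -- Balancedness is preserved, since all differences of two rows are shifted by a constant.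
  have row : ∀ i p q s t : Fin 6, Function.Injective ![i, 0, p, q, s, t] →
      Balanced (L i p - L 0 p - L i 0) (L i q - L 0 q - L i 0) (L i s - L 0 s - L i 0)
        (L i t - L 0 t - L i 0) := fun i p q s t hg => (h _ hg).sub _
  have pair : ∀ i j q s t : Fin 6, Function.Injective ![i, j, 0, q, s, t] →
      Balanced 0 (L i q - L 0 q - L i 0 - (L j q - L 0 q - L j 0))
        (L i s - L 0 s - L i 0 - (L j s - L 0 s - L j 0))
        (L i t - L 0 t - L i 0 - (L j t - L 0 t - L j 0)) := by
    intro i j q s t hg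
    convert (h _ hg).sub (L i 0 - L j 0) using 1 <;> simp <;> ring
  exact no_normalized_log_matrix _ _ _ _ (row 1 2 3 4 5 (by decide)) _ _ _ _
    (row 2 1 3 4 5 (by decide)) (pair 1 2 3 4 5 (by decide)) _ _ _ _ (row 3 1 2 4 5 (by decide))
    (pair 1 3 2 4 5 (by decide)) (pair 2 3 1 4 5 (by decide)) _ _ _ _
    (row 4 1 2 3 5 (by decide)) (pair 1 4 2 3 5 (by decide)) (pair 2 4 1 3 5 (by decide))
    (pair 3 4 1 2 5 (by decide))

/-! ### Hermitian self-orthogonal codes of length twelve -/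

section Words

variable {ι : Type*} [Fintype ι]

/-- The number of coordinates where both words are nonzero. -/
def commonCard (u v : ι → F4) : ℕ := #{i | u i ≠ 0 ∧ v i ≠ 0}

/-- The number of nonzero coordinates of `u` that agree with the multiple `turn k v` of `v`. -/
def agreeCard (k : ZMod 3) (u v : ι → F4) : ℕ := #{i | u i ≠ 0 ∧ u i = F4.turn k (v i)}

theorem commonCard_eq_sum_agreeCard (u v : ι → F4) :
    commonCard u v = agreeCard 0 u v + agreeCard 1 u v + agreeCard 2 u v := by
  have key : ∀ x y : F4, (if x ≠ 0 ∧ y ≠ 0 then 1 else 0) =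
      (if x ≠ 0 ∧ x = F4.turn 0 y then 1 else 0) + (if x ≠ 0 ∧ x = F4.turn 1 y then 1 else 0) +
      (if x ≠ 0 ∧ x = F4.turn 2 y then 1 else 0) := by decide
  simp only [commonCard, agreeCard, card_filter, key, sum_add_distrib]

/-- In `u + turn k v`, of the common nonzero coordinates exactly those where `u` agrees with `turn
k v` cancel. -/
theorem hammingNorm_add_turn (k : ZMod 3) (u v : ι → F4) :
    hammingNorm (fun i => u i + F4.turn k (v i)) + commonCard u v + agreeCard k u v =
      hammingNorm u + hammingNorm v := by
  have key : ∀ (k : ZMod 3) (x y : F4), (if x + F4.turn k y ≠ 0 then 1 else 0) +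
      (if x ≠ 0 ∧ y ≠ 0 then 1 else 0) + (if x ≠ 0 ∧ x = F4.turn k y then 1 else 0) =
      (if x ≠ 0 then 1 else 0) + (if y ≠ 0 then 1 else 0) := by decide
  simp only [commonCard, agreeCard, hammingNorm, card_filter, ← sum_add_distrib, key]

/-- `E` is (as an additive group) an `𝔽₄`-linear code that is Hermitian self-orthogonal and has
minimum weight at least `5`. For an `𝔽₄`-linear code, self-orthogonality under the Hermitian form
is equivalent to self-orthogonality under its trace. -/
structure IsHermitianCode (E : Submodule (ZMod 2) (ι → F4)) : Prop where
  turn_mem : ∀ k, ∀ u ∈ E, (fun i => F4.turn k (u i)) ∈ E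
  isotropic : ∀ u ∈ E, ∀ v ∈ E, ∑ i, F4.form (u i) (v i) = 0
  dist : ∀ u ∈ E, u ≠ 0 → 5 ≤ hammingNorm u

namespace IsHermitianCode

variable {E : Submodule (ZMod 2) (ι → F4)}

/-- The weight of `u` modulo `2` is the Hermitian norm of `u`, which is `form u (turn 1 u)`. -/
theorem even_hammingNorm (hE : IsHermitianCode E) {u : ι → F4} (hu : u ∈ E) :
    hammingNorm u % 2 = 0 := by
  have h := hE.isotropic u hu _ (hE.turn_mem 1 u hu)
  simp only [F4.form_turn_one, sum_boole] at h
  exact Nat.even_iff.1 ((ZMod.natCast_eq_zero_iff_even).1 h)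

theorem six_le_hammingNorm (hE : IsHermitianCode E) {u : ι → F4} (hu : u ∈ E) (h0 : u ≠ 0) :
    6 ≤ hammingNorm u := by
  have := hE.even_hammingNorm hu
  have := hE.dist u hu h0
  omega

/-- The word `u + turn k v` is nonzero, since `v` vanishes somewhere on the support of `u`, and
its weight is `12 - commonCard u v - agreeCard k u v`, which must be even and at least `6`. -/
theorem agreeCard_of_hammingNorm_eq_six (hE : IsHermitianCode E) {u v : ι → F4}
    (hu : u ∈ E) (hv : v ∈ E) (hu6 : hammingNorm u = 6) (hv6 : hammingNorm v = 6)
    (hne : ∃ i, u i ≠ 0 ∧ v i = 0) (k : ZMod 3) :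
    agreeCard k u v % 2 = commonCard u v % 2 ∧ agreeCard k u v + commonCard u v ≤ 6 := by
  have hm : (fun i => u i + F4.turn k (v i)) ∈ E := E.add_mem hu (hE.turn_mem k v hv)
  have h0 : (fun i => u i + F4.turn k (v i)) ≠ 0 := by
    obtain ⟨i, hi, hi'⟩ := hne
    have ht : ∀ k : ZMod 3, F4.turn k 0 = 0 := by decide
    intro h
    have := congrFun h i
    simp only [hi', ht, add_zero, Pi.zero_apply] at this
    exact hi this
  have h1 := hE.six_le_hammingNorm hm h0
  have h2 := hE.even_hammingNorm hm
  have h3 := hammingNorm_add_turn k u v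
  omega

/-- The three agreement numbers add up to the size `m` of the common support and each is at most
`6 - m`, so `4 * m ≤ 18`. -/
theorem commonCard_le_four (hE : IsHermitianCode E) {u v : ι → F4} (hu : u ∈ E) (hv : v ∈ E)
    (hu6 : hammingNorm u = 6) (hv6 : hammingNorm v = 6) (hne : ∃ i, u i ≠ 0 ∧ v i = 0) :
    commonCard u v ≤ 4 := by
  have h := hE.agreeCard_of_hammingNorm_eq_six hu hv hu6 hv6 hne
  have h0 := h 0
  have h1 := h 1
  have h2 := h 2
  have := commonCard_eq_sum_agreeCard u v
  omega

/-- If the common support is the range of `f`, so has four elements, each agreement number is even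
and at most two. Hence the ratios of `u` and `v` on it take two values, each of them twice. -/
theorem balanced (hE : IsHermitianCode E) {u v : ι → F4} (hu : u ∈ E) (hv : v ∈ E)
    (hu6 : hammingNorm u = 6) (hv6 : hammingNorm v = 6) (hne : ∃ i, u i ≠ 0 ∧ v i = 0)
    {f : Fin 4 → ι} (hf : f.Injective) (hc : ∀ i, u i ≠ 0 ∧ v i ≠ 0 ↔ ∃ a, f a = i) :
    Balanced (F4.log (u (f 0)) - F4.log (v (f 0))) (F4.log (u (f 1)) - F4.log (v (f 1)))
      (F4.log (u (f 2)) - F4.log (v (f 2))) (F4.log (u (f 3)) - F4.log (v (f 3))) := by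
  classical
  have hset : ({i | u i ≠ 0 ∧ v i ≠ 0} : Finset ι) = univ.map ⟨f, hf⟩ := by
    ext i; simp [← hc]
  have hcard : commonCard u v = 4 := by simp [commonCard, hset]
  have hag : ∀ k, agreeCard k u v =
      ∑ a, if F4.log (u (f a)) - F4.log (v (f a)) = k then 1 else 0 := by
    intro k
    have key : ∀ (k : ZMod 3) (x y : F4), x ≠ 0 ∧ x = F4.turn k y ↔
      (x ≠ 0 ∧ y ≠ 0) ∧ F4.log x - F4.log y = k := by decide
    simp only [agreeCard, key]
    rw [← filter_filter, hset, card_filter, sum_map]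
    rfl
  apply balanced_of_counts
  intro k
  have h := hE.agreeCard_of_hammingNorm_eq_six hu hv hu6 hv6 hne k
  rw [hcard, hag, Fin.sum_univ_four] at h
  intro m
  omega

theorem exists_vanishing (E : Submodule (ZMod 2) (ι → F4)) {T : Finset ι}
    (hT : 2 * #T < Module.finrank (ZMod 2) E) : ∃ u ∈ E, u ≠ 0 ∧ ∀ i ∈ T, u i = 0 := by
  let g : E →ₗ[ZMod 2] (T → F4) := (LinearMap.funLeft (ZMod 2) F4 Subtype.val) ∘ₗ E.subtype
  have hlt : Module.finrank (ZMod 2) (T → F4) < Module.finrank (ZMod 2) E := by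
    simpa [Module.finrank_pi_fintype, mul_comm] using hT
  obtain ⟨u, hu, hu0⟩ := (Submodule.ne_bot_iff _).1
    (LinearMap.ker_ne_bot_of_finrank_lt (f := g) hlt)
  refine ⟨u, u.2, by simpa using hu0, fun i hi => ?_⟩
  exact congrFun (LinearMap.mem_ker.1 hu) ⟨i, hi⟩

theorem hammingNorm_add_card_zeros [DecidableEq ι] (u : ι → F4) (hι : Fintype.card ι = 12) :
    hammingNorm u + #{i | u i = 0} = 12 := by
  rw [← hι, ← card_univ, add_comm, hammingNorm, card_filter_add_card_filter_not]

theorem hammingNorm_eq_six (hE : IsHermitianCode E) (hι : Fintype.card ι = 12) {u : ι → F4}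
    (hu : u ∈ E) (h0 : u ≠ 0) {T : Finset ι} (hT : #T = 5) (hz : ∀ i ∈ T, u i = 0) :
    hammingNorm u = 6 := by
  classical
  have h1 : #T ≤ #{i | u i = 0} := card_le_card fun i hi => by simpa using hz i hi
  have h2 := hammingNorm_add_card_zeros u hι
  have h3 := hE.six_le_hammingNorm hu h0
  have h4 := hE.even_hammingNorm hu
  omega

/-- A nonzero word vanishing on five coordinates vanishes at exactly one further coordinate. -/
theorem exists_zero_outside (hE : IsHermitianCode E) (hι : Fintype.card ι = 12) {u : ι → F4}
    (hu : u ∈ E) (h0 : u ≠ 0) {T : Finset ι} (hT : #T = 5) (hz : ∀ i ∈ T, u i = 0) :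
    ∃ z ∉ T, ∀ i, u i = 0 ↔ i = z ∨ i ∈ T := by
  classical
  have h6 := hE.hammingNorm_eq_six hι hu h0 hT hz
  have h2 := hammingNorm_add_card_zeros u hι
  have hs : T ⊆ ({i | u i = 0} : Finset ι) := fun i hi => by simpa using hz i hi
  obtain ⟨z, hzT, he⟩ := exists_eq_insert_iff.2 ⟨hs, by omega⟩
  refine ⟨z, hzT, fun i => ?_⟩
  have := Finset.ext_iff.1 he i
  simpa using this.symm

/-- Six coordinates that determine the words of the code. A word `u` vanishing on five coordinates
`T` has weight `6`; adding to `T` a coordinate of the support of `u` works, since another word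
vanishing there would share five nonzero coordinates with `u`. -/
theorem exists_information_set [DecidableEq ι] (hE : IsHermitianCode E) (hι : Fintype.card ι = 12)
    (hdim : 12 ≤ Module.finrank (ZMod 2) E) :
    ∃ S : Finset ι, #S = 6 ∧ ∀ v ∈ E, (∀ i ∈ S, v i = 0) → v = 0 := by
  obtain ⟨T, -, hT⟩ := exists_subset_card_eq (s := (univ : Finset ι)) (n := 5) (by simp [hι])
  obtain ⟨u, hu, hu0, huT⟩ := exists_vanishing E (T := T) (by omega)
  obtain ⟨z, hzT, hz⟩ := hE.exists_zero_outside hι hu hu0 hT huT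
  obtain ⟨h, hh⟩ := Function.ne_iff.1 hu0
  have hhT : h ∉ T := fun hm => hh (huT h hm)
  refine ⟨insert h T, by simp [hhT, hT], fun v hv hvS => ?_⟩
  by_contra hv0
  have hvT : ∀ i ∈ T, v i = 0 := fun i hi => hvS i (mem_insert_of_mem hi)
  have hvh : v h = 0 := hvS h (mem_insert_self _ _)
  obtain ⟨y, hyT, hy⟩ := hE.exists_zero_outside hι hv hv0 hT hvT
  have hyh : h = y := ((hy h).1 hvh).resolve_right hhT
  have h4 := hE.commonCard_le_four hu hv (hE.hammingNorm_eq_six hι hu hu0 hT huT)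
    (hE.hammingNorm_eq_six hι hv hv0 hT hvT) ⟨h, hh, hvh⟩
  have hset : ({i | u i ≠ 0 ∧ v i ≠ 0} : Finset ι) = (insert z (insert h T))ᶜ := by
    ext i; simp [hz, hy, ← hyh]; tauto
  have : #(insert z (insert h T)) ≤ 7 := (card_insert_le _ _).trans (by simp [hhT, hT])
  rw [commonCard, hset, card_compl, hι] at h4
  omega

/-- A Hermitian self-orthogonal code of length `12` over `𝔽₄` with minimum weight at least `5` is
not self-dual: its dimension over `𝔽₄` is less than `6`. -/
theorem finrank_lt (hE : IsHermitianCode E) (hι : Fintype.card ι = 12) :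
    Module.finrank (ZMod 2) E < 12 := by
  classical
  by_contra! hdim
  obtain ⟨S, hS, hinj⟩ := hE.exists_information_set hι hdim
  obtain ⟨e⟩ : Nonempty (Fin 6 ≃ S) := ⟨(Fintype.equivFinOfCardEq (by simp [hS])).symm⟩
  have hcard : ∀ a, #(S.erase (e a)) = 5 := fun a => by rw [card_erase_of_mem (e a).2, hS]
  -- The rows of a generator matrix that is diagonal on the information set `S`.
  have hrow : ∀ a, ∃ u ∈ E, u ≠ 0 ∧ ∀ i ∈ S.erase (e a), u i = 0 := fun a =>
    exists_vanishing E (by rw [hcard]; omega)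
  choose r hrE hr0 hrS using hrow
  have hr6 : ∀ a, hammingNorm (r a) = 6 := fun a =>
    hE.hammingNorm_eq_six hι (hrE a) (hr0 a) (hcard a) (hrS a)
  have hzero : ∀ a, ∃ z ∉ S.erase (e a : ι), ∀ i, r a i = 0 ↔ i = z ∨ i ∈ S.erase (e a : ι) :=
    fun a => hE.exists_zero_outside hι (hrE a) (hr0 a) (hcard a) (hrS a)
  choose z hz' hz using hzero
  have hpivot : ∀ a, r a (e a) ≠ 0 := by
    intro a ha
    refine hr0 a (hinj _ (hrE a) fun i hi => ?_)
    by_cases hia : i = e a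
    · rw [hia, ha]
    · exact hrS a i (mem_erase.2 ⟨hia, hi⟩)
  have hzS : ∀ a, z a ∉ S := by
    intro a ha
    by_cases hia : z a = e a
    · exact hpivot a ((hz a _).2 (Or.inl hia.symm))
    · exact hz' a (mem_erase.2 ⟨hia, ha⟩)
  have hoff : ∀ a b, a ≠ b → r b (e a) = 0 := fun a b hab =>
    hrS b _ (mem_erase.2 ⟨fun h => hab (e.injective (Subtype.ext h)), (e a).2⟩)
  have hne : ∀ a b, a ≠ b → ∃ i, r a i ≠ 0 ∧ r b i = 0 := fun a b hab =>
    ⟨e a, hpivot a, hoff a b hab⟩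
  have hcommon : ∀ a b, a ≠ b → ∀ i, r a i ≠ 0 ∧ r b i ≠ 0 ↔ i ∉ S ∧ i ≠ z a ∧ i ≠ z b := by
    intro a b hab i
    by_cases hi : i ∈ S
    · refine iff_of_false ?_ fun h => h.1 hi
      rintro ⟨hac, hbc⟩
      obtain ⟨c, hc⟩ := e.surjective ⟨i, hi⟩
      obtain rfl : (e c : ι) = i := congrArg Subtype.val hc
      revert hbc
      rw [imp_false, not_not]
      by_cases hcb : c = b
      · exact absurd (hoff c a (by rintro rfl; exact hab hcb)) hac
      · exact hoff c b hcb
    · simp [hz, hi]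
  -- If two rows had their zero outside `S` in the same place, they would share five coordinates.
  have hzinj : z.Injective := by
    intro a b hzab
    by_contra hab
    have h4 := hE.commonCard_le_four (hrE a) (hrE b) (hr6 a) (hr6 b) (hne a b hab)
    have hset : ({i | r a i ≠ 0 ∧ r b i ≠ 0} : Finset ι) = (insert (z a) S)ᶜ := by
      ext i; simp [hcommon a b hab, ← hzab]; tauto
    rw [commonCard, hset, card_compl, hι, card_insert_of_notMem (hzS a), hS] at h4
    omega
  have hzimage : ∀ i, i ∉ S → ∃ c, z c = i := by
    have himage : univ.image z = Sᶜ := by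
      apply eq_of_subset_of_card_le
      · intro i hi
        obtain ⟨c, -, rfl⟩ := mem_image.1 hi
        exact mem_compl.2 (hzS c)
      · rw [card_image_of_injective _ hzinj, card_compl, hι, hS]; simp
    intro i hi
    have : i ∈ univ.image z := himage ▸ mem_compl.2 hi
    simpa using this
  -- Ordering the coordinates outside `S` by `z` puts these zeros on the diagonal.
  refine no_log_matrix (fun a c => F4.log (r a (z c))) fun g hg => ?_
  have hab : g 0 ≠ g 1 := hg.ne (by decide)
  refine hE.balanced (hrE (g 0)) (hrE (g 1)) (hr6 _) (hr6 _) (hne _ _ hab)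
    (f := fun l => z (g (Fin.natAdd 2 l)))
    (hzinj.comp (hg.comp (Fin.natAdd_injective 4 2))) fun i => ?_
  rw [hcommon _ _ hab]
  constructor
  · rintro ⟨hi, hi0, hi1⟩
    obtain ⟨c, rfl⟩ := hzimage i hi
    obtain ⟨l, rfl⟩ := (Finite.injective_iff_surjective.1 hg) c
    have hl : ∀ l : Fin 6, l ≠ 0 → l ≠ 1 → ∃ m : Fin 4, Fin.natAdd 2 m = l := by decide
    obtain ⟨m, rfl⟩ := hl l (fun h => hi0 (h ▸ rfl)) (fun h => hi1 (h ▸ rfl))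
    exact ⟨m, rfl⟩
  · rintro ⟨m, rfl⟩
    have hm : ∀ m : Fin 4, Fin.natAdd 2 m ≠ (0 : Fin 6) ∧ Fin.natAdd 2 m ≠ (1 : Fin 6) := by
      decide
    exact ⟨hzS _, hzinj.ne (hg.ne (hm m).1), hzinj.ne (hg.ne (hm m).2)⟩

end IsHermitianCode

end Words

/-! ### Permutations whose nontrivial cycles are 3-cycles -/

theorem sum_support_of_card_three {α M : Type*} [Fintype α] [DecidableEq α] [AddCommMonoid M]
    {c : Equiv.Perm α} (hc : c.IsCycle) (h3 : #c.support = 3) {x : α} (hx : x ∈ c.support)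
    (f : α → M) : ∑ j ∈ c.support, f j = f x + f (c x) + f (c (c x)) := by
  have hpow : c (c (c x)) = x := by
    have h := pow_orderOf_eq_one c
    rw [hc.orderOf, h3] at h
    simpa [pow_succ] using congrArg (· x) h
  have h1 : c x ≠ x := Equiv.Perm.mem_support.1 hx
  have h2 : c (c x) ≠ x := fun h => h1 (by rw [← congrArg c h, hpow])
  have hcard : #{x, c x, c (c x)} = 3 := by
    rw [card_eq_three]
    exact ⟨x, c x, c (c x), h1.symm, h2.symm, fun h => h1 (c.injective h).symm, rfl⟩
  have hset : c.support = {x, c x, c (c x)} := by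
    symm
    apply eq_of_subset_of_card_le
    · intro y hy
      simp only [mem_insert, mem_singleton] at hy
      rcases hy with rfl | rfl | rfl <;> simpa using h1
    · rw [hcard, h3]
  rw [hset, sum_insert, sum_insert, sum_singleton, add_assoc]
  · simpa using fun h => h1 h.symm
  · simp [h1.symm, h2.symm]

/-- If all nontrivial cycles of `σ` are 3-cycles, sums over all points split into the fixed points
and the cycles `{r, σ r, σ² r}`, for a choice of one point `r` on each cycle. -/
theorem exists_cycle_representatives {α : Type*} [Fintype α] [DecidableEq α]
    {σ : Equiv.Perm α} (h3 : ∀ m ∈ σ.cycleType, m = 3) :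
    ∃ rep : σ.cycleFactorsFinset → α, ∀ {M : Type} [AddCommMonoid M] (f : α → M),
      ∑ j, f j = ∑ j with σ j = j, f j +
        ∑ c, (f (rep c) + f (σ (rep c)) + f (σ (σ (rep c)))) := by
  have hcyc : ∀ c : σ.cycleFactorsFinset,
      (c : Equiv.Perm α).IsCycle ∧ #(c : Equiv.Perm α).support = 3 := by
    intro c
    refine ⟨(Equiv.Perm.mem_cycleFactorsFinset_iff.1 c.2).1, h3 _ ?_⟩
    rw [Equiv.Perm.cycleType_def]
    exact Multiset.mem_map_of_mem _ c.2
  have hrep : ∀ c : σ.cycleFactorsFinset, ∃ x, x ∈ (c : Equiv.Perm α).support := fun c =>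
    card_pos.1 (by rw [(hcyc c).2]; norm_num)
  choose rep hrep using hrep
  refine ⟨rep, fun {M} _ f => ?_⟩
  have happly : ∀ c : σ.cycleFactorsFinset, ∀ x ∈ (c : Equiv.Perm α).support,
      (c : Equiv.Perm α) x = σ x := fun c =>
    (Equiv.Perm.mem_cycleFactorsFinset_iff.1 c.2).2
  have hfiber : ∀ c : σ.cycleFactorsFinset,
      ∑ j with σ j ≠ j ∧ σ.cycleOf j = c, f j = f (rep c) + f (σ (rep c)) + f (σ (σ (rep c))) := by
    intro c
    have hset : ({j | σ j ≠ j ∧ σ.cycleOf j = c} : Finset α) = (c : Equiv.Perm α).support := by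
      ext j
      simp only [mem_filter, mem_univ, true_and]
      constructor
      · rintro ⟨hj, hc⟩
        rw [← hc, Equiv.Perm.mem_support, Equiv.Perm.cycleOf_apply_self]
        exact hj
      · intro hj
        refine ⟨?_, (Equiv.Perm.cycle_is_cycleOf hj c.2).symm⟩
        rw [← happly c j hj]
        exact Equiv.Perm.mem_support.1 hj
    have h1 := happly c _ (hrep c)
    have h2 := happly c _ (Equiv.Perm.apply_mem_support.2 (hrep c))
    rw [hset, sum_support_of_card_three (hcyc c).1 (hcyc c).2 (hrep c), h2, h1]
  rw [← sum_filter_add_sum_filter_not univ (fun j => σ j = j)]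
  congr 1
  rw [← sum_fiberwise_of_maps_to (t := σ.cycleFactorsFinset) (g := σ.cycleOf),
    ← sum_coe_sort]
  · refine sum_congr rfl fun c _ => ?_
    rw [← hfiber c, filter_filter]
  · intro j hj
    rw [Equiv.Perm.cycleOf_mem_cycleFactorsFinset_iff, Equiv.Perm.mem_support]
    simpa using hj

/-! ### Codes with an automorphism of order three -/

/-- A self-orthogonal code has at most half the dimension of the ambient space. -/
theorem two_mul_finrank_le_card {κ K : Type*} [Fintype κ] [Field K]
    (W : Submodule K (κ → K)) (hW : ∀ u ∈ W, ∀ v ∈ W, u ⬝ᵥ v = 0) :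
    2 * Module.finrank K W ≤ Fintype.card κ := by
  classical
  have hle : W.map (dotProductEquiv K κ).toLinearMap ≤ W.dualAnnihilator := by
    rintro _ ⟨u, hu, rfl⟩
    rw [Submodule.mem_dualAnnihilator]
    intro v hv
    simpa using hW u hu v hv
  have h1 := Submodule.finrank_mono hle
  have h2 := Subspace.finrank_add_finrank_dualAnnihilator_eq W
  rw [LinearEquiv.finrank_map_eq] at h1
  rw [Module.finrank_pi] at h2
  omega

/-- The operator `1 + σ + σ²` on binary vectors. When `σ ^ 3 = 1` its values are constant on the
cycles of `σ`, and its kernel is a module over `𝔽₄ = 𝔽₂[σ] / (1 + σ + σ²)`. -/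
def orbitTrace {n : ℕ} (σ : Equiv.Perm (Fin n)) : (Fin n → ZMod 2) →ₗ[ZMod 2] (Fin n → ZMod 2) :=
  let R := LinearMap.funLeft (ZMod 2) (ZMod 2) σ
  LinearMap.id + R + R ∘ₗ R

theorem orbitTrace_apply {n : ℕ} (σ : Equiv.Perm (Fin n)) (v : Fin n → ZMod 2) (j : Fin n) :
    orbitTrace σ v j = v j + v (σ j) + v (σ (σ j)) := rfl

theorem IsAutomorphism.comp_mem {n : ℕ} {C : Code n} {σ : Equiv.Perm (Fin n)}
    (h : IsAutomorphism C σ) {v : Fin n → ZMod 2} (hv : v ∈ C) : (fun i => v (σ i)) ∈ C := by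
  have hv' : v ∈ permute σ '' (C : Set (Fin n → ZMod 2)) := h.symm ▸ hv
  obtain ⟨w, hw, rfl⟩ := hv'
  simpa [permute] using hw

theorem HasMinDist.le_hammingNorm {n d : ℕ} {C : Code n} (h : HasMinDist C d)
    {v : Fin n → ZMod 2} (hv : v ∈ C) (h0 : v ≠ 0) : d ≤ hammingNorm v :=
  h.2 ⟨v, hv, 0, C.zero_mem, h0, hammingDist_zero_right v⟩

/-- Restricting cycle-constant vectors to one point of each cycle preserves the inner product,
because cycles have odd length. So the values of `1 + σ + σ²` on a self-orthogonal code form, up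
to isomorphism, a self-orthogonal code whose length is the number of cycles, fixed points
included. -/
theorem two_mul_finrank_range_orbitTrace_le {n : ℕ} {C : Code n} {σ : Equiv.Perm (Fin n)}
    (hC : ∀ u ∈ C, ∀ v ∈ C, u ⬝ᵥ v = 0) (hσ : IsAutomorphism C σ)
    (h3 : ∀ m ∈ σ.cycleType, m = 3) :
    2 * Module.finrank (ZMod 2) ((orbitTrace σ).domRestrict C).range ≤
      #{j | σ j = j} + #σ.cycleFactorsFinset := by
  obtain ⟨rep, hrep⟩ := exists_cycle_representatives h3
  have hpow : ∀ j, σ (σ (σ j)) = j := by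
    intro j
    have h : σ ^ 3 = 1 := by
      rw [← orderOf_dvd_iff_pow_eq_one, ← Equiv.Perm.lcm_cycleType, Multiset.lcm_dvd]
      intro m hm
      rw [h3 m hm]
    simpa [pow_succ] using congrArg (· j) h
  set F := ((orbitTrace σ).domRestrict C).range
  have hinv : ∀ w ∈ F, ∀ j, w (σ j) = w j := by
    rintro _ ⟨v, rfl⟩ j
    simp only [LinearMap.domRestrict_apply, orbitTrace_apply, hpow]
    ring
  have hFC : ∀ w ∈ F, w ∈ C := by
    rintro _ ⟨v, rfl⟩
    exact C.add_mem (C.add_mem v.2 (hσ.comp_mem v.2)) (hσ.comp_mem (hσ.comp_mem v.2))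
  let r : {j // σ j = j} ⊕ σ.cycleFactorsFinset → Fin n := Sum.elim Subtype.val rep
  let P := LinearMap.funLeft (ZMod 2) (ZMod 2) r
  have hdot : ∀ u ∈ F, ∀ v ∈ F, P u ⬝ᵥ P v = 0 := by
    intro u hu v hv
    rw [← hC u (hFC u hu) v (hFC v hv)]
    simp only [dotProduct, hrep (fun j => u j * v j), hinv u hu, hinv v hv, Fintype.sum_sum_type]
    have hx : ∀ x : ZMod 2, x + x + x = x := by decide
    simp only [hx]
    rw [sum_subtype (p := fun j => σ j = j) _ (by simp)]
    rfl
  have hinj : Function.Injective (P.domRestrict F) := by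
    rw [← LinearMap.ker_eq_bot, LinearMap.ker_eq_bot']
    rintro ⟨w, hw⟩ h0
    have hr : ∀ i, w (r i) = 0 := congrFun h0
    -- Counting the nonzero coordinates of `w` cycle by cycle shows that there are none.
    have hs := hrep fun j => if w j = 0 then 0 else 1
    simp only [hinv w hw, show ∀ c, w (rep c) = 0 from fun c => hr (Sum.inr c)] at hs
    rw [sum_eq_zero (s := {j | σ j = j}) fun j hj => if_pos (hr (Sum.inl ⟨j, by simpa using hj⟩))]
      at hs
    have hw0 : ∀ j, w j = 0 := by simpa using hs
    ext j
    exact hw0 j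
  rw [← LinearMap.finrank_range_of_inj hinj]
  refine (two_mul_finrank_le_card _ ?_).trans (by simp [Fintype.card_subtype])
  rintro _ ⟨u, rfl⟩ _ ⟨v, rfl⟩
  exact hdot u u.2 v v.2

/-- The values of a binary vector at `r` and `σ r`, for each chosen point `r`. On a 3-cycle where
the vector has even weight they determine its third value. -/
def cycleValues {n : ℕ} {κ : Type*} (σ : Equiv.Perm (Fin n)) (rep : κ → Fin n) :
    (Fin n → ZMod 2) →ₗ[ZMod 2] (κ → F4) where
  toFun v c := (v (rep c), v (σ (rep c)))
  map_add' _ _ := rfl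
  map_smul' _ _ := rfl

/-- The kernel of `1 + σ + σ²` on a self-orthogonal code, read cycle by cycle, is a Hermitian
self-orthogonal code over `𝔽₄`. Its words vanish at the fixed points of `σ` and have even weight
on each cycle, so their binary weight is twice their weight over `𝔽₄`; a binary weight of at least
`9` therefore gives a weight of at least `5` over `𝔽₄`. -/
theorem exists_isHermitianCode {n : ℕ} {C : Code n} {σ : Equiv.Perm (Fin n)}
    (hC : ∀ u ∈ C, ∀ v ∈ C, u ⬝ᵥ v = 0) (hd : ∀ v ∈ C, v ≠ 0 → 9 ≤ hammingNorm v)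
    (hσ : IsAutomorphism C σ) (h3 : ∀ m ∈ σ.cycleType, m = 3) :
    ∃ E : Submodule (ZMod 2) (σ.cycleFactorsFinset → F4), IsHermitianCode E ∧
      Module.finrank (ZMod 2) E + Module.finrank (ZMod 2) ((orbitTrace σ).domRestrict C).range =
        Module.finrank (ZMod 2) C := by
  obtain ⟨rep, hrep⟩ := exists_cycle_representatives h3
  set Φ := cycleValues σ rep
  set K : Code n := C ⊓ (orbitTrace σ).ker
  have hK2 : ∀ v ∈ K, ∀ j, v (σ (σ j)) = v j + v (σ j) := by
    intro v hv j
    have h := congrFun (LinearMap.mem_ker.1 hv.2) j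
    rw [orbitTrace_apply, Pi.zero_apply] at h
    have hx : ∀ x y z : ZMod 2, x + y + z = 0 → z = x + y := by decide
    exact hx _ _ _ h
  have hK0 : ∀ v ∈ K, ∀ j, σ j = j → v j = 0 := by
    intro v hv j hj
    have h := hK2 v hv j
    simp only [hj] at h
    simpa using h
  have hKσ : ∀ v ∈ K, (fun i => v (σ i)) ∈ K := fun v hv =>
    ⟨hσ.comp_mem hv.1, LinearMap.mem_ker.2 (funext fun j =>
      congrFun (LinearMap.mem_ker.1 hv.2) (σ j))⟩
  have hΦσ : ∀ v ∈ K, Φ (fun i => v (σ i)) = fun c => F4.turn 1 (Φ v c) := by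
    intro v hv
    funext c
    exact Prod.ext rfl (hK2 v hv (rep c))
  have hnorm : ∀ v ∈ K, hammingNorm v = 2 * hammingNorm (Φ v) := by
    intro v hv
    have h := hrep fun j => if v j ≠ 0 then 1 else 0
    rw [sum_eq_zero (s := {j | σ j = j}) fun j hj => if_neg
      (not_not.2 (hK0 v hv j (by simpa using hj))), zero_add] at h
    have key : ∀ x y : ZMod 2, (if x ≠ 0 then 1 else 0) + (if y ≠ 0 then 1 else 0) +
        (if x + y ≠ 0 then 1 else 0) = 2 * if ((x, y) : F4) ≠ 0 then 1 else 0 := by decide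
    simp only [hK2 v hv, key] at h
    rw [hammingNorm, card_filter, h, ← mul_sum, hammingNorm, card_filter]
    rfl
  have hinj : Function.Injective (Φ.domRestrict K) := by
    rw [← LinearMap.ker_eq_bot, LinearMap.ker_eq_bot']
    rintro ⟨v, hv⟩ h0
    have h := hnorm v hv
    rw [show Φ v = 0 from h0, hammingNorm_zero, mul_zero, hammingNorm_eq_zero] at h
    exact Subtype.ext h
  have hturn : ∀ u ∈ (Φ.domRestrict K).range, (fun c => F4.turn 1 (u c)) ∈
      (Φ.domRestrict K).range := by
    rintro _ ⟨v, rfl⟩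
    exact ⟨⟨_, hKσ v v.2⟩, hΦσ v v.2⟩
  refine ⟨(Φ.domRestrict K).range, ⟨?_, ?_, ?_⟩, ?_⟩
  · intro k u hu
    have h2 : ∀ x, F4.turn 2 x = F4.turn 1 (F4.turn 1 x) := by decide
    have hk : k = 0 ∨ k = 1 ∨ k = 2 := by revert k; decide
    rcases hk with rfl | rfl | rfl
    · exact hu
    · exact hturn u hu
    · simpa only [h2] using hturn _ (hturn u hu)
  · rintro _ ⟨⟨u, hu⟩, rfl⟩ _ ⟨⟨v, hv⟩, rfl⟩
    have h := hC u hu.1 v hv.1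
    rw [dotProduct, hrep, sum_eq_zero (s := {j | σ j = j}) fun j hj => by
      rw [hK0 u hu j (by simpa using hj), zero_mul], zero_add] at h
    rw [← h]
    refine sum_congr rfl fun c _ => ?_
    have key : ∀ x y x' y' : ZMod 2,
        F4.form (x, y) (x', y') = x * x' + y * y' + (x + y) * (x' + y') := by decide
    rw [hK2 u hu, hK2 v hv, ← key]
    rfl
  · rintro _ ⟨⟨v, hv⟩, rfl⟩ h0
    have h1 : v ≠ 0 := by
      rintro rfl
      exact h0 (map_zero Φ)
    have h2 := hd v hv.1 h1
    have h3 := hnorm v hv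
    change 5 ≤ hammingNorm (Φ v)
    omega
  · rw [LinearMap.finrank_range_of_inj hinj, add_comm,
      ← ((orbitTrace σ).domRestrict C).finrank_range_add_finrank_ker]
    congr 1
    rw [LinearMap.ker_domRestrict, ← Submodule.finrank_map_subtype_eq, Submodule.map_comap_subtype]

end BinaryCode

theorem mainTheorem5 :
    ¬ ∃ (C : BinaryCode.Code 48) (σ : Equiv.Perm (Fin 48)),
      BinaryCode.HasParameters C 24 10 ∧
      BinaryCode.IsSelfDual C ∧
      BinaryCode.IsAutomorphism C σ ∧
      BinaryCode.HasType σ 3 12 12 := by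
  rintro ⟨C, σ, ⟨hdim, hdist⟩, hself, hσ, hcycle, hfix⟩
  have hC : ∀ u ∈ C, ∀ v ∈ C, u ⬝ᵥ v = 0 := by
    intro u hu
    rw [hself] at hu
    exact hu
  have h3 : ∀ m ∈ σ.cycleType, m = 3 := by
    rw [hcycle]
    exact fun m => Multiset.eq_of_mem_replicate
  have hcard : σ.cycleFactorsFinset.card = 12 := by
    have h := congrArg Multiset.card hcycle
    rwa [Equiv.Perm.cycleType_def, Multiset.card_map, Multiset.card_replicate] at h
  -- The dimension of the image is at most `(12 + 12) / 2`, so that of the kernel is at least `12`.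
  have hF := BinaryCode.two_mul_finrank_range_orbitTrace_le hC hσ h3
  obtain ⟨E, hE, hsum⟩ := BinaryCode.exists_isHermitianCode hC
    (fun v hv h0 => (by norm_num : 9 ≤ 10).trans (hdist.le_hammingNorm hv h0)) hσ h3
  have hlt := hE.finrank_lt (by simpa using hcard)
  omega
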